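/- Work in $\mathbb{CP}^2=\mathbb{C}^2\cup\mathcal L_\infty$; a conic is a smooth conic. Let $\gamma,\Gamma\subset\mathbb{CP}^2$ be conics. A *Poncelet quadrilateral* consists of vertices $V_1,\dots,V_4\in\Gamma$ and sides $\ell_1,\dots,\ell_4$ tangent to $\gamma$ (indices mod $4$) such that, counted with multiplicity, $V_i,V_{i+1}$ are the two intersection points of $\ell_i$ with $\Gamma$, and $\ell_i,\ell_{i+1}$ are the two tangents to $\gamma$ through $V_{i+1}$. It is *degenerate* if some $V_i\in\gamma\cap\Gamma$ or some tangent $T_{V_i}\Gamma$ is also tangent to $\gamma$. Assume that $\gamma,\Gamma$ admit a $1$-parameter family of Poncelet quadrilaterals, i.e. every flag $(p,\ell)$ with $p\in\Gamma\cap\ell$ and $\ell$ tangent to $\gamma$ is the first vertex and first side $(V_1,\ell_1)$ of a Poncelet quadrilateral. For a polygon $P$ with finite vertices $V_i=(x_i,y_i)\in\mathbb{C}^2$ put $$A(P)=\tfrac12\sum_i (x_iy_{i+1}-x_{i+1}y_i),$$ $$CM_2(P)=\Big[\sum_i (x_iy_{i+1}-x_{i+1}y_i)(x_i+x_{i+1})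 : \sum_i (x_iy_{i+1}-x_{i+1}y_i)(y_i+y_{i+1}) : 6A(P)\Big],$$ $$CCM(P)=\Big[\sum_i y_i(x_{i-1}^2+y_{i-1}^2-x_{i+1}^2-y_{i+1}^2) : -\sum_i x_i(x_{i-1}^2+y_{i-1}^2-x_{i+1}^2-y_{i+1}^2) : 4A(P)\Big],$$ each being undefined if its three coordinates all vanish (for $A(P)\ne0$ these are the usual center of mass of the lamina and circumcenter of mass). **Proposition.** Suppose that there is one non-degenerate Poncelet quadrilateral with finite vertices and area zero. Then every Poncelet quadrilateral with finite vertices has area zero. Moreover, there are $a,b\in\mathbb{C}$, not both $0$, such that for every non-degenerate Poncelet quadrilateral $P$ with finite vertices $$CM_2(P)=[a:b:0],$$ and $$CCM(P)=[-b:a:0]$$ unless the points $[a:b:0]$ and $[-b:a:0]$ are conjugate with respect to $\Gamma$ (that is, all chords of $\Gamma$ in the direction $(a,b)$ have the same perpendicular bisector); in that exceptional case, which depends only on $\Gamma$ and $[a:b:0]$, $CCM(P)$ is undefined for all such $P$. For the degenerate Poncelet quadrilaterals with finite vertices both $CM_2$ and $CCM$ are undefined. -/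

import Mathlib

namespace Poncelet

open scoped LinearAlgebra.Projectivization

/-- The complex projective plane. Lines are also represented by points of this type, through their
coefficient vectors: the line with coefficients `l` consists of the points `p` with
`l ⬝ᵥ p = 0`. -/
abbrev Plane := ℙ ℂ (Fin 3 → ℂ)

/-- Incidence: the point `p` lies on the line with coefficients `l`. -/
def OnLine (p l : Plane) : Prop := Projectivization.orthogonal p l

theorem onLine_mk {p l : Fin 3 → ℂ} (hp : p ≠ 0) (hl : l ≠ 0) :
    OnLine (Projectivization.mk ℂ p hp) (Projectivization.mk ℂ l hl) ↔ p ⬝ᵥ l = 0 :=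
  Iff.rfl

/-- A (smooth) conic of the complex projective plane, given by an invertible symmetric matrix. -/
structure Conic where
  mat : Matrix (Fin 3) (Fin 3) ℂ
  isSymm : mat.IsSymm
  det_ne_zero : mat.det ≠ 0

namespace Conic

variable (C : Conic)

theorem mulVecLin_injective : Function.Injective C.mat.mulVecLin :=
  Matrix.mulVec_injective_iff_isUnit.mpr
    ((Matrix.isUnit_iff_isUnit_det _).mpr (isUnit_iff_ne_zero.mpr C.det_ne_zero))

/-- The polar line of a point: for `p = [v]` it has coefficients `C.mat *ᵥ v`. -/
noncomputable def polar (p : Plane) : Plane :=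
  Projectivization.map C.mat.mulVecLin C.mulVecLin_injective p

/-- Two points are conjugate with respect to the conic if one lies on the polar of the other. -/
def Conjugate (p q : Plane) : Prop := OnLine p (C.polar q)

/-- The points of the conic. -/
def points : Set Plane := {p | C.Conjugate p p}

theorem mk_mem_points {v : Fin 3 → ℂ} (hv : v ≠ 0) :
    Projectivization.mk ℂ v hv ∈ C.points ↔ v ⬝ᵥ (C.mat.mulVec v) = 0 :=
  Iff.rfl

/-- The tangent line to the conic at a point `p` of it (for a smooth conic this is the polar
of `p`). -/
noncomputable def tangentLine (p : Plane) : Plane := C.polar p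

/-- The set of all tangent lines of the conic. -/
def tangents : Set Plane := C.tangentLine '' C.points

end Conic

/-- A Poncelet `n`-gon for the pair `γ`, `Γ`: its vertices `V i` lie on `Γ`, its sides `l i` are
tangent to `γ`, and the side `l i` joins `V i` to `V (i + 1)` (indices modulo `n`). Moreover, with
multiplicities counted, `V i` and `V (i + 1)` are the two intersection points of `l i` with `Γ`,
and `l i` and `l (i + 1)` are the two tangents to `γ` through `V (i + 1)`: two consecutive vertices
coincide only if the side is tangent to `Γ` there, and two consecutive sides coincide only if their
common vertex is on `γ`. -/
structure PonceletPolygon (γ Γ : Conic) (n : ℕ) [NeZero n] where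
  vertex : Fin n → Plane
  side : Fin n → Plane
  vertex_mem : ∀ i, vertex i ∈ Γ.points
  side_mem : ∀ i, side i ∈ γ.tangents
  vertex_onLine : ∀ i, OnLine (vertex i) (side i)
  next_onLine : ∀ i, OnLine (vertex (i + 1)) (side i)
  side_eq_tangent : ∀ i, vertex i = vertex (i + 1) → side i = Γ.tangentLine (vertex i)
  vertex_mem_inner : ∀ i, side i = side (i + 1) → vertex (i + 1) ∈ γ.points

/-- The pair `γ`, `Γ` admits a `1`-parameter family of Poncelet `n`-gons: every flag `(p, l)` with
`p` on `Γ`, `l` tangent to `γ` and `p` on `l` starts a closed Poncelet `n`-gon. -/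
def AdmitsFamily (γ Γ : Conic) (n : ℕ) [NeZero n] : Prop :=
  ∀ p ∈ Γ.points, ∀ l ∈ γ.tangents, OnLine p l →
    ∃ P : PonceletPolygon γ Γ n, P.vertex 0 = p ∧ P.side 0 = l

/-- A Poncelet polygon is degenerate if some vertex lies on `γ`, or the tangent to `Γ` at some
vertex is also tangent to `γ`. -/
def PonceletPolygon.IsDegenerate {γ Γ : Conic} {n : ℕ} [NeZero n]
    (P : PonceletPolygon γ Γ n) : Prop :=
  ∃ i, P.vertex i ∈ γ.points ∩ Γ.points ∨ Γ.tangentLine (P.vertex i) ∈ γ.tangents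

/-- The finite point `[x : y : 1]`. -/
noncomputable def finitePoint (v : ℂ × ℂ) : Plane :=
  Projectivization.mk ℂ ![v.1, v.2, 1] fun h => one_ne_zero (congrFun h 2)

/-- The point at infinity `[a : b : 0]`. -/
noncomputable def infinitePoint (a b : ℂ) (h : a ≠ 0 ∨ b ≠ 0) : Plane :=
  Projectivization.mk ℂ ![a, b, 0] fun e =>
    h.elim (fun ha => ha (congrFun e 0)) (fun hb => hb (congrFun e 1))

/-- All vertices of the Poncelet polygon are finite, with affine coordinates `W i`. -/
def PonceletPolygon.HasVertices {γ Γ : Conic} {n : ℕ} [NeZero n]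
    (P : PonceletPolygon γ Γ n) (W : Fin n → ℂ × ℂ) : Prop :=
  ∀ i, P.vertex i = finitePoint (W i)

section Centers

variable {n : ℕ} [NeZero n] (W : Fin n → ℂ × ℂ)

/-- The algebraic area of the polygon with vertices `W i`. -/
noncomputable def area : ℂ :=
  (1 / 2) * ∑ i, ((W i).1 * (W (i + 1)).2 - (W (i + 1)).1 * (W i).2)

/-- Homogeneous coordinates of the center of mass of the homogeneous lamina. -/
noncomputable def cm2Coord : Fin 3 → ℂ :=
  ![∑ i, ((W i).1 * (W (i + 1)).2 - (W (i + 1)).1 * (W i).2) * ((W i).1 + (W (i + 1)).1),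
    ∑ i, ((W i).1 * (W (i + 1)).2 - (W (i + 1)).1 * (W i).2) * ((W i).2 + (W (i + 1)).2),
    6 * area W]

/-- Homogeneous coordinates of the circumcenter of mass. -/
noncomputable def ccmCoord : Fin 3 → ℂ :=
  ![∑ i, (W i).2 * ((W (i - 1)).1 ^ 2 + (W (i - 1)).2 ^ 2
      - (W (i + 1)).1 ^ 2 - (W (i + 1)).2 ^ 2),
    ∑ i, -(W i).1 * ((W (i - 1)).1 ^ 2 + (W (i - 1)).2 ^ 2
      - (W (i + 1)).1 ^ 2 - (W (i + 1)).2 ^ 2),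
    4 * area W]

open Classical in
/-- The point with the given homogeneous coordinates; undefined if they are all zero. -/
noncomputable def toPoint (v : Fin 3 → ℂ) : Option Plane :=
  if h : v ≠ 0 then some (Projectivization.mk ℂ v h) else none

/-- The center of mass `CM₂` as a point of the projective plane. -/
noncomputable def CM2 : Option Plane := toPoint (cm2Coord W)

/-- The circumcenter of mass as a point of the projective plane. -/
noncomputable def CCM : Option Plane := toPoint (ccmCoord W)

theorem toPoint_eq_finitePoint (x y t : ℂ) (ht : t ≠ 0) :
    toPoint ![x, y, t] = some (finitePoint (1 / t * x, 1 / t * y)) := by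
  have h : (![x, y, t] : Fin 3 → ℂ) ≠ 0 := fun e => ht (congrFun e 2)
  rw [toPoint, dif_pos h, finitePoint]
  congr 1
  rw [Projectivization.mk_eq_mk_iff']
  refine ⟨t, ?_⟩
  ext i
  fin_cases i <;> simp [ht]

/-- For non-zero area, `CM₂` is the finite point given by the usual formula. -/
theorem CM2_eq_of_area_ne_zero (hA : area W ≠ 0) :
    CM2 W = some (finitePoint
      (1 / (6 * area W) *
        ∑ i, ((W i).1 * (W (i + 1)).2 - (W (i + 1)).1 * (W i).2) * ((W i).1 + (W (i + 1)).1),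
       1 / (6 * area W) *
        ∑ i, ((W i).1 * (W (i + 1)).2 - (W (i + 1)).1 * (W i).2) *
          ((W i).2 + (W (i + 1)).2))) :=
  toPoint_eq_finitePoint _ _ _ (mul_ne_zero (by norm_num) hA)

/-- For non-zero area, the circumcenter of mass is the finite point given by the usual formula. -/
theorem CCM_eq_of_area_ne_zero (hA : area W ≠ 0) :
    CCM W = some (finitePoint
      (1 / (4 * area W) *
        ∑ i, (W i).2 * ((W (i - 1)).1 ^ 2 + (W (i - 1)).2 ^ 2
          - (W (i + 1)).1 ^ 2 - (W (i + 1)).2 ^ 2),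
       1 / (4 * area W) *
        ∑ i, -(W i).1 * ((W (i - 1)).1 ^ 2 + (W (i - 1)).2 ^ 2
          - (W (i + 1)).1 ^ 2 - (W (i + 1)).2 ^ 2))) :=
  toPoint_eq_finitePoint _ _ _ (mul_ne_zero (by norm_num) hA)

end Centers

end Poncelet

namespace Poncelet

open Matrix

/-! ### Isotropic vectors of a nondegenerate ternary quadratic form -/

section Isotropic

variable {M : Matrix (Fin 3) (Fin 3) ℂ} {a b c n : Fin 3 → ℂ}

/-! Twice the area of a quadrilateral is the cross product of its diagonals, so area zero means that
the diagonals are parallel. The key fact is that the diagonals of all nondegenerate Poncelet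
quadrilaterals pass through one fixed point O. If one such quadrilateral has area zero, O is a point
at infinity [a:b:0]; then all diagonals have direction (a,b) and all areas vanish.

To find O, one nondegenerate quadrilateral is turned into the square (±1,±1,1) by a projective
change of coordinates (`PonceletPolygon.exists_symmetricFrame`). Both conics then become invariant
under (x,y,z) ↦ (-x,-y,z), and O is the center (0,0,1). For any other nondegenerate quadrilateral,
consecutive sides satisfy a relation involving only their slopes (`SymmetricFrame.slope_relation`).
Applied twice, it shows that opposite sides have the same slope; being distinct, they are exchanged
by the symmetry (`SymmetricFrame.eq_smul_reflection`). So are opposite vertices, which gives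
`SymmetricFrame.diagonal`.

For diagonals s(a,b) and t(a,b), `coord_of_parallel_diagonals` exhibits the two centers as multiples
of [a:b:0] and [-b:a:0]. The first factor is nonzero because no three vertices are collinear. The
second vanishes exactly when the line through the midpoints of the diagonals is perpendicular to
them; that line is the polar of [a:b:0], whence the conjugacy condition. In a degenerate
quadrilateral vertices coincide so that the edge contributions cancel in pairs. -/

theorem dotProduct_mulVec_comm (hM : M.IsSymm) (a b : Fin 3 → ℂ) :
    a ⬝ᵥ M *ᵥ b = b ⬝ᵥ M *ᵥ a := by
  rw [dotProduct_mulVec, ← mulVec_transpose, hM.eq, dotProduct_comm]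

theorem exists_smul_eq_of_cross_eq_zero (ha : a ≠ 0) (h : a ⨯₃ b = 0) : ∃ c : ℂ, b = c • a := by
  by_contra! hc
  refine crossProduct_ne_zero_iff_linearIndependent.mpr ?_ h
  rw [LinearIndependent.pair_iff' ha]
  exact fun c => (hc c).symm

theorem exists_smul_cross_eq (hab : a ⨯₃ b ≠ 0) (ha : n ⬝ᵥ a = 0) (hb : n ⬝ᵥ b = 0) :
    ∃ c : ℂ, n = c • (a ⨯₃ b) := by
  refine exists_smul_eq_of_cross_eq_zero hab ?_
  rw [cross_cross_eq_smul_sub_smul, dotProduct_comm a n, dotProduct_comm b n, ha, hb]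
  simp

theorem mulVec_ne_zero (hdet : M.det ≠ 0) (ha : a ≠ 0) : M *ᵥ a ≠ 0 := fun h =>
  hdet (exists_mulVec_eq_zero_iff.mp ⟨a, ha, h⟩)

/-- A nondegenerate ternary quadratic form has no isotropic plane. -/
theorem cross_eq_zero_of_isotropic (hM : M.IsSymm) (hdet : M.det ≠ 0)
    (ha : a ⬝ᵥ M *ᵥ a = 0) (hb : b ⬝ᵥ M *ᵥ b = 0) (hab : a ⬝ᵥ M *ᵥ b = 0) : a ⨯₃ b = 0 := by
  by_contra h
  have ha0 : a ≠ 0 := by rintro rfl; simp at h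
  have hb0 : b ≠ 0 := by rintro rfl; simp at h
  have hba := dotProduct_mulVec_comm hM b a
  obtain ⟨s, hs⟩ := exists_smul_cross_eq h ((dotProduct_comm _ _).trans ha)
    ((dotProduct_comm _ _).trans (hba.trans hab))
  obtain ⟨t, ht⟩ := exists_smul_cross_eq h ((dotProduct_comm _ _).trans hab)
    ((dotProduct_comm _ _).trans hb)
  have hs0 : s ≠ 0 := by
    rintro rfl
    exact mulVec_ne_zero hdet ha0 (by simpa using hs)
  -- `M *ᵥ a` and `M *ᵥ b` are both multiples of `a ⨯₃ b`, so `M` kills this combination.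
  have hz : t • a - s • b = 0 := by
    by_contra hne
    refine mulVec_ne_zero hdet hne ?_
    rw [mulVec_sub, mulVec_smul, mulVec_smul, hs, ht, smul_smul, smul_smul, mul_comm, sub_self]
  apply h
  have : b = (s⁻¹ * t) • a := by
    rw [mul_smul, sub_eq_zero.mp hz, smul_smul, inv_mul_cancel₀ hs0, one_smul]
  rw [this, map_smul, cross_self, smul_zero]

/-- Three isotropic vectors in a plane cannot be pairwise independent. -/
theorem cross_eq_zero_or_of_isotropic (hM : M.IsSymm) (hdet : M.det ≠ 0) (hn : n ≠ 0)
    (ha : a ⬝ᵥ M *ᵥ a = 0) (hb : b ⬝ᵥ M *ᵥ b = 0) (hc : c ⬝ᵥ M *ᵥ c = 0)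
    (hna : n ⬝ᵥ a = 0) (hnb : n ⬝ᵥ b = 0) (hnc : n ⬝ᵥ c = 0) (hab : a ⨯₃ b ≠ 0) :
    c ⨯₃ a = 0 ∨ c ⨯₃ b = 0 := by
  have hdet0 : (Matrix.of ![a, b, c]).det = 0 := by
    refine exists_mulVec_eq_zero_iff.mp ⟨n, hn, ?_⟩
    ext i
    fin_cases i <;> simp [mulVec, dotProduct_comm _ n, hna, hnb, hnc]
  obtain ⟨v, hv, hv0⟩ := exists_vecMul_eq_zero_iff.mpr hdet0
  have hlin : v 0 • a + v 1 • b + v 2 • c = 0 := by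
    rw [← hv0]
    ext j
    simp [vecMul, dotProduct, Fin.sum_univ_three]
  have hz : v 2 ≠ 0 := by
    intro h2
    rw [h2, zero_smul, add_zero] at hlin
    refine crossProduct_ne_zero_iff_linearIndependent.mp hab |> fun hli => hv ?_
    obtain ⟨h0, h1⟩ := LinearIndependent.pair_iff.mp hli _ _ hlin
    ext i
    fin_cases i <;> simp [h0, h1, h2]
  have hceq : c = (-(v 2)⁻¹ * v 0) • a + (-(v 2)⁻¹ * v 1) • b := by
    have : v 2 • c = -(v 0 • a + v 1 • b) := by
      rw [eq_neg_iff_add_eq_zero, add_comm]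
      exact hlin
    rw [mul_smul, mul_smul, ← smul_add, neg_smul, ← smul_neg, ← this, smul_smul,
      inv_mul_cancel₀ hz, one_smul]
  generalize -(v 2)⁻¹ * v 0 = x at hceq
  generalize -(v 2)⁻¹ * v 1 = y at hceq
  subst hceq
  have hne : a ⬝ᵥ M *ᵥ b ≠ 0 := fun h => hab (cross_eq_zero_of_isotropic hM hdet ha hb h)
  simp only [mulVec_add, mulVec_smul, add_dotProduct, dotProduct_add, smul_dotProduct,
    dotProduct_smul, ha, hb, dotProduct_mulVec_comm hM b a, smul_eq_mul] at hc
  -- On the plane spanned by the isotropic `a`, `b` the form is `2xy` times `a ⬝ᵥ M *ᵥ b`.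
  have hxy : x * y * (a ⬝ᵥ M *ᵥ b) = 0 := by linear_combination hc / 2
  rcases mul_eq_zero.mp ((mul_eq_zero.mp hxy).resolve_right hne) with rfl | rfl
  · right; simp [cross_self]
  · left; simp [cross_self]

end Isotropic

/-! ### Lines, conics and the dual conic -/

theorem OnLine.symm {p l : Plane} (h : OnLine p l) : OnLine l p :=
  Projectivization.orthogonal_comm.mp h

theorem onLine_iff_rep {p l : Plane} : OnLine p l ↔ p.rep ⬝ᵥ l.rep = 0 := by
  conv_lhs => rw [← p.mk_rep, ← l.mk_rep]
  exact onLine_mk p.rep_nonzero l.rep_nonzero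

theorem cross_rep_eq_zero_iff {p q : Plane} : p.rep ⨯₃ q.rep = 0 ↔ p = q := by
  conv_rhs => rw [← p.mk_rep, ← q.mk_rep]
  exact (Projectivization.mk_eq_mk_iff_crossProduct_eq_zero _ _).symm

namespace Conic

variable (C : Conic)

theorem conjugate_mk {v w : Fin 3 → ℂ} (hv : v ≠ 0) (hw : w ≠ 0) :
    C.Conjugate (Projectivization.mk ℂ v hv) (Projectivization.mk ℂ w hw) ↔
      v ⬝ᵥ C.mat *ᵥ w = 0 :=
  Iff.rfl

theorem conjugate_iff_rep {p q : Plane} :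
    C.Conjugate p q ↔ p.rep ⬝ᵥ C.mat *ᵥ q.rep = 0 := by
  conv_lhs => rw [← p.mk_rep, ← q.mk_rep]
  exact C.conjugate_mk p.rep_nonzero q.rep_nonzero

theorem mem_points_iff_rep {p : Plane} : p ∈ C.points ↔ p.rep ⬝ᵥ C.mat *ᵥ p.rep = 0 :=
  C.conjugate_iff_rep

/-- Two distinct conjugate points of the conic would span an isotropic plane. Geometrically, a
tangent line meets the conic only at its point of contact. -/
theorem eq_of_conjugate {p q : Plane} (hp : p ∈ C.points) (hq : q ∈ C.points)
    (h : C.Conjugate p q) : p = q :=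
  cross_rep_eq_zero_iff.mp <| cross_eq_zero_of_isotropic C.isSymm C.det_ne_zero
    (C.mem_points_iff_rep.mp hp) (C.mem_points_iff_rep.mp hq) (C.conjugate_iff_rep.mp h)

/-- A line meets a conic in at most two points. -/
theorem eq_or_eq_of_onLine {p q r l : Plane} (hp : p ∈ C.points) (hq : q ∈ C.points)
    (hr : r ∈ C.points) (hpl : OnLine p l) (hql : OnLine q l) (hrl : OnLine r l) (hpq : p ≠ q) :
    r = p ∨ r = q := by
  rw [← cross_rep_eq_zero_iff, ← cross_rep_eq_zero_iff]
  exact cross_eq_zero_or_of_isotropic C.isSymm C.det_ne_zero l.rep_nonzero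
    (C.mem_points_iff_rep.mp hp) (C.mem_points_iff_rep.mp hq) (C.mem_points_iff_rep.mp hr)
    (onLine_iff_rep.mp hpl.symm) (onLine_iff_rep.mp hql.symm) (onLine_iff_rep.mp hrl.symm)
    (cross_rep_eq_zero_iff.not.mpr hpq)

/-- The dual conic, whose points are the tangent lines. -/
noncomputable def dual : Conic where
  mat := C.mat⁻¹
  isSymm := by rw [IsSymm, transpose_nonsing_inv, C.isSymm.eq]
  det_ne_zero := by
    rw [det_nonsing_inv, Ring.inverse_eq_inv']
    exact inv_ne_zero C.det_ne_zero

theorem dual_mulVec_mulVec (v : Fin 3 → ℂ) : C.dual.mat *ᵥ (C.mat *ᵥ v) = v := by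
  rw [mulVec_mulVec, dual, nonsing_inv_mul _ (isUnit_iff_ne_zero.mpr C.det_ne_zero), one_mulVec]

theorem dual_polar_polar (p : Plane) : C.dual.polar (C.polar p) = p := by
  induction p using Projectivization.ind with | h v hv =>
  simp only [polar, Projectivization.map_mk, mulVecLin_apply]
  congr 1
  exact C.dual_mulVec_mulVec v

theorem mem_dual_points {l : Plane} (hl : l ∈ C.tangents) : l ∈ C.dual.points := by
  obtain ⟨p, hp, rfl⟩ := hl
  change OnLine (C.polar p) (C.dual.polar (C.polar p))
  rw [dual_polar_polar]
  exact OnLine.symm hp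

/-- Through a point of the conic passes only one tangent. -/
theorem eq_tangentLine {p l : Plane} (hp : p ∈ C.points) (hl : l ∈ C.tangents)
    (h : OnLine p l) : l = C.tangentLine p := by
  obtain ⟨q, hq, rfl⟩ := hl
  rw [C.eq_of_conjugate hp hq h]

end Conic

theorem finitePoint_injective : Function.Injective finitePoint := by
  rintro ⟨x, y⟩ ⟨x', y'⟩ h
  rw [finitePoint, finitePoint, Projectivization.mk_eq_mk_iff'] at h
  obtain ⟨c, hc⟩ := h
  have h2 := congrFun hc 2
  have h0 := congrFun hc 0
  have h1 := congrFun hc 1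
  simp at h0 h1 h2
  subst h2
  simp_all

/-! ### Coincidences among vertices and sides; the degenerate case -/

namespace PonceletPolygon

variable {γ Γ : Conic}

section

variable {n : ℕ} [NeZero n] (P : PonceletPolygon γ Γ n)

theorem vertex_ne_next (hP : ¬ P.IsDegenerate) (i : Fin n) : P.vertex i ≠ P.vertex (i + 1) :=
  fun h => hP ⟨i, Or.inr (P.side_eq_tangent i h ▸ P.side_mem i)⟩

theorem side_ne_next (hP : ¬ P.IsDegenerate) (i : Fin n) : P.side i ≠ P.side (i + 1) :=
  fun h => hP ⟨i + 1, Or.inl ⟨P.vertex_mem_inner i h, P.vertex_mem _⟩⟩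

/-- If the two sides at a vertex agree then the two neighbouring vertices agree. -/
theorem vertex_eq_of_side_eq {i : Fin n} (h : P.side i = P.side (i + 1)) :
    P.vertex i = P.vertex (i + 1 + 1) := by
  have h0 := P.vertex_onLine i
  have h1 := P.next_onLine i
  have h2 : OnLine (P.vertex (i + 1 + 1)) (P.side i) := h ▸ P.next_onLine (i + 1)
  have htangent : ∀ j, P.side i = Γ.tangentLine (P.vertex (i + 1)) → OnLine (P.vertex j) (P.side i)
      → P.vertex j = P.vertex (i + 1) := fun j hs hj =>
    Γ.eq_of_conjugate (P.vertex_mem j) (P.vertex_mem _) (hs ▸ hj :)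
  by_cases h01 : P.vertex i = P.vertex (i + 1)
  · rw [h01]
    exact (htangent _ (by rw [P.side_eq_tangent i h01, h01]) h2).symm
  by_cases h12 : P.vertex (i + 1) = P.vertex (i + 1 + 1)
  · rw [← h12]
    exact htangent _ (by rw [h, P.side_eq_tangent (i + 1) h12]) h0
  · exact ((Γ.eq_or_eq_of_onLine (P.vertex_mem i) (P.vertex_mem _) (P.vertex_mem (i + 1 + 1))
      h0 h1 h2 h01).resolve_right (Ne.symm h12)).symm

/-- Otherwise two distinct consecutive sides would share both of the distinct vertices `i` and `i +
1`. -/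
theorem vertex_ne_next_next (hP : ¬ P.IsDegenerate) (i : Fin n) :
    P.vertex i ≠ P.vertex (i + 1 + 1) := by
  intro h
  refine P.side_ne_next hP i ?_
  have h2 : OnLine (P.vertex i) (P.side (i + 1)) := h ▸ P.next_onLine (i + 1)
  by_contra hs
  rw [← cross_rep_eq_zero_iff] at hs
  obtain ⟨c, hc⟩ := exists_smul_cross_eq hs (onLine_iff_rep.mp (P.vertex_onLine i))
    (onLine_iff_rep.mp h2)
  obtain ⟨d, hd⟩ := exists_smul_cross_eq hs (onLine_iff_rep.mp (P.next_onLine i))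
    (onLine_iff_rep.mp (P.vertex_onLine (i + 1)))
  refine P.vertex_ne_next hP i (cross_rep_eq_zero_iff.mp ?_)
  rw [hc, hd]
  simp [cross_self]

/-- If a vertex is repeated and the sides there are distinct, then the polygon retraces itself. -/
theorem vertex_eq_of_vertex_eq {i : Fin n} (h : P.vertex (i + 1) = P.vertex (i + 1 + 1))
    (h1 : P.side i ≠ P.side (i + 1)) (h2 : P.side (i + 1) ≠ P.side (i + 1 + 1)) :
    P.vertex i = P.vertex (i + 1 + 1 + 1) := by
  have hT := P.side_eq_tangent (i + 1) h
  -- All three sides pass through the doubled vertex, from which only two tangents to γ emanate.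
  have hside : P.side (i + 1 + 1) = P.side i :=
    (γ.dual.eq_or_eq_of_onLine (γ.mem_dual_points (P.side_mem i))
      (γ.mem_dual_points (P.side_mem (i + 1))) (γ.mem_dual_points (P.side_mem (i + 1 + 1)))
      (P.next_onLine i).symm (P.vertex_onLine (i + 1)).symm
      (h ▸ (P.vertex_onLine (i + 1 + 1)).symm :) h1).resolve_right h2.symm
  have h01 : P.vertex i ≠ P.vertex (i + 1) := fun e =>
    h1 (by rw [P.side_eq_tangent i e, e, hT])
  have h23 : P.vertex (i + 1 + 1) ≠ P.vertex (i + 1 + 1 + 1) := fun e =>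
    h2 (by rw [P.side_eq_tangent (i + 1 + 1) e, ← h, hT])
  exact ((Γ.eq_or_eq_of_onLine (P.vertex_mem i) (P.vertex_mem _) (P.vertex_mem _)
    (P.vertex_onLine i) (P.next_onLine i) (hside ▸ P.next_onLine (i + 1 + 1) :) h01).resolve_right
    (h ▸ h23.symm :)).symm

/-- A vertex on γ makes its two sides agree, so the polygon folds back there. A Γ-tangent that also
touches γ must be a side, whose two vertices then coincide; the polygon retraces itself around it.
-/
theorem IsDegenerate.exists_vertex_eq {P : PonceletPolygon γ Γ n} (hP : P.IsDegenerate) :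
    (∃ i, P.vertex i = P.vertex (i + 1 + 1)) ∨
      ∃ i, P.vertex (i + 1) = P.vertex (i + 1 + 1) ∧ P.vertex i = P.vertex (i + 1 + 1 + 1) := by
  obtain ⟨j, hj⟩ := hP
  by_cases hs : ∃ i, P.side i = P.side (i + 1)
  · obtain ⟨i, hi⟩ := hs
    exact Or.inl ⟨i, P.vertex_eq_of_side_eq hi⟩
  push Not at hs
  obtain ⟨i, rfl⟩ : ∃ i, j = i + 1 := ⟨j - 1, (sub_add_cancel j 1).symm⟩
  have hn := (P.next_onLine i)
  have hv := (P.vertex_onLine (i + 1))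
  rcases hj with hj | hj
  · exact absurd ((γ.eq_tangentLine hj.1 (P.side_mem _) hn).trans
      (γ.eq_tangentLine hj.1 (P.side_mem _) hv).symm) (hs i)
  right
  have key : ∀ k, P.vertex k = P.vertex (k + 1) →
      ∃ i, P.vertex (i + 1) = P.vertex (i + 1 + 1) ∧ P.vertex i = P.vertex (i + 1 + 1 + 1) := by
    intro k hk
    obtain ⟨i, rfl⟩ : ∃ i, k = i + 1 := ⟨k - 1, (sub_add_cancel k 1).symm⟩
    exact ⟨i, hk, P.vertex_eq_of_vertex_eq hk (hs _) (hs _)⟩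
  -- Only two tangents to γ pass through this vertex, so the Γ-tangent there is one of the two
  -- adjacent sides.
  rcases γ.dual.eq_or_eq_of_onLine (γ.mem_dual_points (P.side_mem i))
    (γ.mem_dual_points (P.side_mem (i + 1))) (γ.mem_dual_points hj) hn.symm hv.symm
    (OnLine.symm (P.vertex_mem (i + 1))) (hs i) with e | e
  · exact key i (Γ.eq_of_conjugate (P.vertex_mem _) (P.vertex_mem _)
      (e ▸ P.vertex_onLine i : OnLine (P.vertex i) (Γ.tangentLine (P.vertex (i + 1)))))
  · exact key (i + 1) (Γ.eq_of_conjugate (P.vertex_mem (i + 1 + 1)) (P.vertex_mem (i + 1))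
      (e ▸ P.next_onLine (i + 1) :
        OnLine (P.vertex (i + 1 + 1)) (Γ.tangentLine (P.vertex (i + 1))))).symm

end

/-- All the sums are sums over oriented edges of expressions that change sign with the orientation.
Both patterns of coincidence traverse each edge back and forth. -/
theorem IsDegenerate.coord_eq_zero {P : PonceletPolygon γ Γ 4} (hP : P.IsDegenerate)
    {W : Fin 4 → ℂ × ℂ} (hW : P.HasVertices W) :
    area W = 0 ∧ cm2Coord W = 0 ∧ ccmCoord W = 0 := by
  have hinj : ∀ i j, P.vertex i = P.vertex j → W i = W j := fun i j h =>
    finitePoint_injective (by rw [← hW i, ← hW j, h])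
  suffices h : area W = 0 ∧ cm2Coord W 0 = 0 ∧ cm2Coord W 1 = 0 ∧ ccmCoord W 0 = 0 ∧
      ccmCoord W 1 = 0 by
    obtain ⟨h, h0, h1, k0, k1⟩ := h
    refine ⟨h, ?_, ?_⟩ <;> ext i <;> fin_cases i <;>
      first | assumption | simp [cm2Coord, ccmCoord, h]
  have e1 : (0 : Fin 4) - 1 = 3 := rfl
  have e2 : (2 : Fin 4) - 1 = 1 := rfl
  have e3 : (3 : Fin 4) - 1 = 2 := rfl
  have f1 : (1 : Fin 4) + 1 = 2 := rfl
  have f2 : (2 : Fin 4) + 1 = 3 := rfl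
  have f3 : (3 : Fin 4) + 1 = 0 := rfl
  rcases hP.exists_vertex_eq with ⟨i, hi⟩ | ⟨i, hi, hj⟩
  · replace hi := hinj _ _ hi
    refine ⟨?_, ?_, ?_, ?_, ?_⟩ <;> fin_cases i <;>
      simp [f1, f2, f3] at hi <;>
      simp [area, cm2Coord, ccmCoord, Fin.sum_univ_four, e1, e2, e3, f1, f2, f3, hi] <;> ring
  · replace hi := hinj _ _ hi
    replace hj := hinj _ _ hj
    refine ⟨?_, ?_, ?_, ?_, ?_⟩ <;> fin_cases i <;>
      simp [f1, f2, f3] at hi hj <;>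
      simp [area, cm2Coord, ccmCoord, Fin.sum_univ_four, e1, e2, e3, f1, f2, f3, hi, hj] <;> ring

end PonceletPolygon

/-! ### A projective frame turning one quadrilateral into a square -/

/-- Projective coordinates in which the inner conic has dual equation
`κ (u² + v² - w²) + 2 k u v = 0` and the outer conic has equation
`α (x² - z²) + β (y² - z²) = 0`: both are symmetric under `(x, y, z) ↦ (-x, -y, z)`. -/
structure SymmetricFrame (γ Γ : Conic) where
  (B : Matrix (Fin 3) (Fin 3) ℂ)
  (α β κ k : ℂ)
  det_ne_zero : B.det ≠ 0
  α_ne_zero : α ≠ 0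
  β_ne_zero : β ≠ 0
  κ_ne_zero : κ ≠ 0
  outer : ∀ p, p ⬝ᵥ Γ.mat *ᵥ p =
    α * ((B *ᵥ p) 0 ^ 2 - (B *ᵥ p) 2 ^ 2) + β * ((B *ᵥ p) 1 ^ 2 - (B *ᵥ p) 2 ^ 2)
  inner : ∀ m m', (Bᵀ *ᵥ m) ⬝ᵥ γ.dual.mat *ᵥ (Bᵀ *ᵥ m') =
    κ * (m 0 * m' 0 + m 1 * m' 1 - m 2 * m' 2) + k * (m 0 * m' 1 + m 1 * m' 0)

theorem forall_eq_of_signed_sums {a b c d e f : ℂ}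
    (h1 : a + d + f + 2 * b + 2 * c + 2 * e = 0) (h2 : a + d + f - 2 * b - 2 * c + 2 * e = 0)
    (h3 : a + d + f - 2 * b + 2 * c - 2 * e = 0) (h4 : a + d + f + 2 * b - 2 * c - 2 * e = 0) :
    f = -(a + d) ∧ b = 0 ∧ c = 0 ∧ e = 0 :=
  ⟨by linear_combination (h1 + h2 + h3 + h4) / 4, by linear_combination (h1 - h2 - h3 + h4) / 8,
    by linear_combination (h1 - h2 + h3 - h4) / 8, by linear_combination (h1 + h2 - h3 - h4) / 8⟩

/-- A symmetric form vanishing at the four points `(±1, ±1, 1)`. -/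
theorem form_of_vanishing_at_square {G : Matrix (Fin 3) (Fin 3) ℂ} (hG : G.IsSymm)
    (hdet : G.det ≠ 0)
    (h : ∀ s t : ℂ, s ^ 2 = 1 → t ^ 2 = 1 → ![s, t, 1] ⬝ᵥ G *ᵥ ![s, t, 1] = 0) :
    G 0 0 ≠ 0 ∧ G 1 1 ≠ 0 ∧ ∀ x, x ⬝ᵥ G *ᵥ x =
      G 0 0 * (x 0 ^ 2 - x 2 ^ 2) + G 1 1 * (x 1 ^ 2 - x 2 ^ 2) := by
  have s01 := hG.apply 0 1
  have s02 := hG.apply 0 2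
  have s12 := hG.apply 1 2
  have h1 := h 1 1 (by norm_num) (by norm_num)
  have h2 := h (-1) 1 (by norm_num) (by norm_num)
  have h3 := h 1 (-1) (by norm_num) (by norm_num)
  have h4 := h (-1) (-1) (by norm_num) (by norm_num)
  simp [dotProduct, mulVec, Fin.sum_univ_three, s01, s02, s12] at h1 h2 h3 h4
  obtain ⟨e22, e01, e02, e12⟩ := forall_eq_of_signed_sums (a := G 0 0) (b := G 0 1) (c := G 0 2)
    (d := G 1 1) (e := G 1 2) (f := G 2 2) (by linear_combination h1)
    (by linear_combination h2) (by linear_combination h3) (by linear_combination h4)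
  rw [det_fin_three, s01, s02, s12, e01, e02, e12, e22] at hdet
  refine ⟨fun h0 => hdet (by rw [h0]; ring), fun h0 => hdet (by rw [h0]; ring), fun x => ?_⟩
  simp [dotProduct, mulVec, Fin.sum_univ_three, s01, s02, s12, e01, e02, e12, e22]
  ring

/-- A symmetric form vanishing at `(1, 0, ±1)` and `(0, 1, ±1)`. -/
theorem form_of_vanishing_at_sides {Q : Matrix (Fin 3) (Fin 3) ℂ} (hQ : Q.IsSymm)
    (hdet : Q.det ≠ 0)
    (h : ∀ s : ℂ, s ^ 2 = 1 → ![s, 0, 1] ⬝ᵥ Q *ᵥ ![s, 0, 1] = 0 ∧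
      ![0, s, 1] ⬝ᵥ Q *ᵥ ![0, s, 1] = 0) :
    Q 0 0 ≠ 0 ∧ ∀ m m', m ⬝ᵥ Q *ᵥ m' =
      Q 0 0 * (m 0 * m' 0 + m 1 * m' 1 - m 2 * m' 2) + Q 0 1 * (m 0 * m' 1 + m 1 * m' 0) := by
  have s01 := hQ.apply 0 1
  have s02 := hQ.apply 0 2
  have s12 := hQ.apply 1 2
  obtain ⟨h1, h2⟩ := h 1 (by norm_num)
  obtain ⟨h3, h4⟩ := h (-1) (by norm_num)
  simp [dotProduct, mulVec, Fin.sum_univ_three, s02, s12] at h1 h2 h3 h4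
  have e02 : Q 0 2 = 0 := by linear_combination (h1 - h3) / 4
  have e12 : Q 1 2 = 0 := by linear_combination (h2 - h4) / 4
  have e22 : Q 2 2 = -Q 0 0 := by linear_combination (h1 + h3) / 2
  have e11 : Q 1 1 = Q 0 0 := by linear_combination (h2 + h4 - h1 - h3) / 2
  rw [det_fin_three, s01, s02, s12, e02, e12, e22] at hdet
  refine ⟨fun h0 => hdet (by rw [h0]; ring), fun m m' => ?_⟩
  simp [dotProduct, mulVec, Fin.sum_univ_three, s01, s02, s12, e02, e12, e22, e11]
  ring

namespace PonceletPolygon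

variable {γ Γ : Conic} {n : ℕ} [NeZero n] (P : PonceletPolygon γ Γ n)

/-- A common line would meet Γ in the three distinct vertices `i`, `i + 1`, `i + 2`. -/
theorem side_ne_next_next (hP : ¬ P.IsDegenerate) (i : Fin n) :
    P.side i ≠ P.side (i + 1 + 1) := by
  intro h
  rcases Γ.eq_or_eq_of_onLine (P.vertex_mem i) (P.vertex_mem _) (P.vertex_mem (i + 1 + 1))
    (P.vertex_onLine i) (P.next_onLine i) (h ▸ P.vertex_onLine (i + 1 + 1) :)
    (P.vertex_ne_next hP i) with e | e
  · exact P.vertex_ne_next_next hP i e.symm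
  · exact P.vertex_ne_next hP (i + 1) e.symm

theorem not_onLine_side (hP : ¬ P.IsDegenerate) {i j : Fin n} (h : P.side j ≠ P.side i)
    (h' : P.side j ≠ P.side (i + 1)) :
    (P.vertex (i + 1)).rep ⬝ᵥ (P.side j).rep ≠ 0 := fun hj =>
  (γ.dual.eq_or_eq_of_onLine (γ.mem_dual_points (P.side_mem i))
    (γ.mem_dual_points (P.side_mem (i + 1))) (γ.mem_dual_points (P.side_mem j))
    (P.next_onLine i).symm (P.vertex_onLine (i + 1)).symm (onLine_iff_rep.mpr hj).symm
    (P.side_ne_next hP i)).elim h h'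

end PonceletPolygon

/-- A nondegenerate Poncelet quadrilateral becomes the square with vertices `(±1, ±1, 1)` in
suitable projective coordinates. -/
theorem PonceletPolygon.exists_symmetricFrame {γ Γ : Conic} (P : PonceletPolygon γ Γ 4)
    (hP : ¬ P.IsDegenerate) :
    ∃ (F : SymmetricFrame γ Γ) (z : Fin 4 → ℂ),
      F.B *ᵥ (P.vertex 0).rep = z 0 • ![-1, 1, 1] ∧
      F.B *ᵥ (P.vertex 1).rep = z 1 • ![-1, -1, 1] ∧
      F.B *ᵥ (P.vertex 2).rep = z 2 • ![1, -1, 1] ∧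
      F.B *ᵥ (P.vertex 3).rep = z 3 • ![1, 1, 1] := by
  set l : Fin 4 → Fin 3 → ℂ := fun i => (P.side i).rep
  set v : Fin 4 → Fin 3 → ℂ := fun i => (P.vertex i).rep
  have n01 : P.side 0 ≠ P.side 1 := P.side_ne_next hP 0
  have n12 : P.side 1 ≠ P.side 2 := P.side_ne_next hP 1
  have n23 : P.side 2 ≠ P.side 3 := P.side_ne_next hP 2
  have n30 : P.side 3 ≠ P.side 0 := P.side_ne_next hP 3
  have n02 : P.side 0 ≠ P.side 2 := P.side_ne_next_next hP 0
  have n13 : P.side 1 ≠ P.side 3 := P.side_ne_next_next hP 1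
  have i0 : v 0 ⬝ᵥ l 0 = 0 := onLine_iff_rep.mp (P.vertex_onLine 0)
  have i1 : v 1 ⬝ᵥ l 1 = 0 := onLine_iff_rep.mp (P.vertex_onLine 1)
  have i2 : v 2 ⬝ᵥ l 2 = 0 := onLine_iff_rep.mp (P.vertex_onLine 2)
  have i3 : v 3 ⬝ᵥ l 3 = 0 := onLine_iff_rep.mp (P.vertex_onLine 3)
  have j0 : v 0 ⬝ᵥ l 3 = 0 := onLine_iff_rep.mp (P.next_onLine 3)
  have j1 : v 1 ⬝ᵥ l 0 = 0 := onLine_iff_rep.mp (P.next_onLine 0)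
  have j2 : v 2 ⬝ᵥ l 1 = 0 := onLine_iff_rep.mp (P.next_onLine 1)
  have j3 : v 3 ⬝ᵥ l 2 = 0 := onLine_iff_rep.mp (P.next_onLine 2)
  have k23 : v 2 ⬝ᵥ l 3 ≠ 0 := P.not_onLine_side hP (i := 1) (j := 3) n13.symm n23.symm
  have k13 : v 1 ⬝ᵥ l 3 ≠ 0 := P.not_onLine_side hP (i := 0) (j := 3) n30 n13.symm
  have k30 : v 3 ⬝ᵥ l 0 ≠ 0 := P.not_onLine_side hP (i := 2) (j := 0) n02 n30.symm
  -- The sides 0, 1, 2 are not concurrent: they are three distinct points of the dual conic, hence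
  -- not collinear there.
  have hker : ∀ n, n ⬝ᵥ l 0 = 0 → n ⬝ᵥ l 1 = 0 → n ⬝ᵥ l 2 = 0 → n = 0 := by
    intro n h0 h1 h2
    by_contra hn
    have hq : ∀ j, l j ⬝ᵥ γ.dual.mat *ᵥ l j = 0 := fun j =>
      γ.dual.mem_points_iff_rep.mp (γ.mem_dual_points (P.side_mem j))
    rcases cross_eq_zero_or_of_isotropic γ.dual.isSymm γ.dual.det_ne_zero hn (hq 0) (hq 1) (hq 2)
      h0 h1 h2 (cross_rep_eq_zero_iff.not.mpr n01) with h | h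
    · exact n02 (cross_rep_eq_zero_iff.mp h).symm
    · exact n12 (cross_rep_eq_zero_iff.mp h).symm
  have hdetl : (Matrix.of ![l 0, l 1, l 2]).det ≠ 0 := fun h => by
    obtain ⟨n, hn, hn0⟩ := exists_mulVec_eq_zero_iff.mpr h
    refine hn (hker n ?_ ?_ ?_) <;> rw [dotProduct_comm]
    exacts [congrFun hn0 0, congrFun hn0 1, congrFun hn0 2]
  obtain ⟨x, y, z, hxyz⟩ : ∃ x y z : ℂ, l 3 = x • l 0 + y • l 1 + z • l 2 := by
    have h : (l 3 ᵥ* (Matrix.of ![l 0, l 1, l 2])⁻¹) ᵥ* Matrix.of ![l 0, l 1, l 2] = l 3 := by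
      rw [vecMul_vecMul, nonsing_inv_mul _ (isUnit_iff_ne_zero.mpr hdetl), vecMul_one]
    generalize l 3 ᵥ* (Matrix.of ![l 0, l 1, l 2])⁻¹ = c at h
    refine ⟨c 0, c 1, c 2, ?_⟩
    rw [← h]
    ext j
    simp [vecMul, dotProduct, Fin.sum_univ_three]
  have hdot : ∀ n : Fin 3 → ℂ, n ⬝ᵥ l 3 = x * (n ⬝ᵥ l 0) + y * (n ⬝ᵥ l 1) + z * (n ⬝ᵥ l 2) := by
    intro n
    rw [hxyz]
    simp [dotProduct_add]
  -- A vanishing coefficient would put vertex 2 on side 3 (`x`), vertex 1 on side 3 (`z`), or vertex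
  -- 3 on side 0 (`y`).
  have hx : x ≠ 0 := by
    rintro rfl
    exact k23 (by rw [hdot, j2, i2]; ring)
  have hz : z ≠ 0 := by
    rintro rfl
    exact k13 (by rw [hdot, j1, i1]; ring)
  have hy : y ≠ 0 := by
    rintro rfl
    have := hdot (v 3)
    rw [i3, j3] at this
    simp [hx, k30] at this
  -- With rows X, Y, Z one has X + Z = x·l₀, Z - X = z·l₂, Y + Z = -y·l₁ and Z - Y = l₃, the last
  -- two by `hxyz`. The sides thus become X = ∓Z and Y = ∓Z.
  set B : Matrix (Fin 3) (Fin 3) ℂ := Matrix.of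
    ![(1 / 2 : ℂ) • (x • l 0 - z • l 2), (1 / 2 : ℂ) • (-y • l 1 - l 3),
      (1 / 2 : ℂ) • (x • l 0 + z • l 2)] with hB
  have hB0 : ∀ n, (B *ᵥ n) 0 = (x * (n ⬝ᵥ l 0) - z * (n ⬝ᵥ l 2)) / 2 := fun n => by
    simp [hB, mulVec, dotProduct, Fin.sum_univ_three]
    ring
  have hB1 : ∀ n, (B *ᵥ n) 1 = (-y * (n ⬝ᵥ l 1) - n ⬝ᵥ l 3) / 2 := fun n => by
    simp [hB, mulVec, dotProduct, Fin.sum_univ_three]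
    ring
  have hB2 : ∀ n, (B *ᵥ n) 2 = (x * (n ⬝ᵥ l 0) + z * (n ⬝ᵥ l 2)) / 2 := fun n => by
    simp [hB, mulVec, dotProduct, Fin.sum_univ_three]
    ring
  have hdet : B.det ≠ 0 := fun h => by
    obtain ⟨n, hn, hn0⟩ := exists_mulVec_eq_zero_iff.mpr h
    have h0 := hB0 n
    have h1 := hB1 n
    have h2 := hB2 n
    rw [hdot] at h1
    simp only [hn0, Pi.zero_apply] at h0 h1 h2
    have e0 : x * (n ⬝ᵥ l 0) = 0 := by linear_combination -h0 - h2
    have e2 : z * (n ⬝ᵥ l 2) = 0 := by linear_combination h0 - h2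
    have e1 : y * (n ⬝ᵥ l 1) = 0 := by linear_combination h1 + h2
    exact hn (hker n ((mul_eq_zero.mp e0).resolve_left hx) ((mul_eq_zero.mp e1).resolve_left hy)
      ((mul_eq_zero.mp e2).resolve_left hz))
  have hunit : IsUnit B.det := isUnit_iff_ne_zero.mpr hdet
  have c0 : B *ᵥ v 0 = (B *ᵥ v 0) 2 • ![-1, 1, 1] := by
    have := hdot (v 0)
    rw [i0, j0] at this
    ext i
    fin_cases i <;> simp [hB0, hB1, hB2, i0, j0]
    · ring
    · linear_combination this
  have c1 : B *ᵥ v 1 = (B *ᵥ v 1) 2 • ![-1, -1, 1] := by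
    have := hdot (v 1)
    rw [i1, j1] at this
    ext i
    fin_cases i <;> simp [hB0, hB1, hB2, i1, j1]
    · ring
    · linear_combination -this / 2
  have c2 : B *ᵥ v 2 = (B *ᵥ v 2) 2 • ![1, -1, 1] := by
    have := hdot (v 2)
    rw [i2, j2] at this
    ext i
    fin_cases i <;> simp [hB0, hB1, hB2, i2, j2]
    linear_combination -this / 2
  have c3 : B *ᵥ v 3 = (B *ᵥ v 3) 2 • ![1, 1, 1] := by
    have := hdot (v 3)
    rw [i3, j3] at this
    ext i
    fin_cases i <;> simp [hB0, hB1, hB2, i3, j3]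
    linear_combination this
  set G := (B⁻¹)ᵀ * Γ.mat * B⁻¹ with hG
  have hGsymm : G.IsSymm := by
    rw [IsSymm, hG, transpose_mul, transpose_mul, transpose_transpose, Γ.isSymm.eq, mul_assoc]
  have hGdet : G.det ≠ 0 := by
    rw [hG, det_mul, det_mul, det_transpose]
    have := (B.isUnit_nonsing_inv_det hunit).ne_zero
    exact mul_ne_zero (mul_ne_zero this Γ.det_ne_zero) this
  have hGform : ∀ p, p ⬝ᵥ Γ.mat *ᵥ p = (B *ᵥ p) ⬝ᵥ G *ᵥ (B *ᵥ p) := by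
    intro p
    have hinv : B⁻¹ *ᵥ (B *ᵥ p) = p := by
      rw [mulVec_mulVec, nonsing_inv_mul _ hunit, one_mulVec]
    rw [hG, ← mulVec_mulVec, ← mulVec_mulVec, hinv, dotProduct_mulVec (B *ᵥ p), vecMul_transpose,
      hinv]
  have hGzero : ∀ i w, B *ᵥ v i = (B *ᵥ v i) 2 • w → w ⬝ᵥ G *ᵥ w = 0 := by
    intro i w hw
    have h := Γ.mem_points_iff_rep.mp (P.vertex_mem i)
    rw [hGform] at h
    have h0 : (B *ᵥ v i) 2 ≠ 0 := fun h0 => by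
      rw [h0, zero_smul] at hw
      exact mulVec_ne_zero hdet (P.vertex i).rep_nonzero hw
    change (B *ᵥ v i) ⬝ᵥ G *ᵥ (B *ᵥ v i) = 0 at h
    rw [hw] at h
    simpa [mulVec_smul, h0] using h
  obtain ⟨hα, hβ, hout⟩ := form_of_vanishing_at_square hGsymm hGdet (by
    intro s t hs ht
    rcases sq_eq_one_iff.mp hs with rfl | rfl <;>
      rcases sq_eq_one_iff.mp ht with rfl | rfl
    exacts [hGzero 3 _ c3, hGzero 2 _ c2, hGzero 0 _ c0, hGzero 1 _ c1])
  set Q := B * γ.dual.mat * Bᵀ with hQ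
  have hQsymm : Q.IsSymm := by
    rw [IsSymm, hQ, transpose_mul, transpose_mul, transpose_transpose, γ.dual.isSymm.eq, mul_assoc]
  have hQdet : Q.det ≠ 0 := by
    rw [hQ, det_mul, det_mul, det_transpose]
    exact mul_ne_zero (mul_ne_zero hdet γ.dual.det_ne_zero) hdet
  have hQform : ∀ m m', (Bᵀ *ᵥ m) ⬝ᵥ γ.dual.mat *ᵥ (Bᵀ *ᵥ m') = m ⬝ᵥ Q *ᵥ m' := by
    intro m m'
    rw [hQ, ← mulVec_mulVec, ← mulVec_mulVec, dotProduct_mulVec m, ← mulVec_transpose B]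
  have hQzero : ∀ i (c : ℂ) w, Bᵀ *ᵥ w = c • l i → w ⬝ᵥ Q *ᵥ w = 0 := by
    intro i c w hw
    have h : l i ⬝ᵥ γ.dual.mat *ᵥ l i = 0 :=
      γ.dual.mem_points_iff_rep.mp (γ.mem_dual_points (P.side_mem i))
    rw [← hQform, hw]
    simp [mulVec_smul, h]
  have hBT : ∀ w j, (Bᵀ *ᵥ w) j = B 0 j * w 0 + B 1 j * w 1 + B 2 j * w 2 := fun w j => by
    simp [mulVec, dotProduct, Fin.sum_univ_three]
  obtain ⟨hκ, hin⟩ := form_of_vanishing_at_sides hQsymm hQdet (by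
    intro s hs
    have hl3 := fun j => congrFun hxyz j
    simp only [Pi.add_apply, Pi.smul_apply, smul_eq_mul] at hl3
    rcases sq_eq_one_iff.mp hs with rfl | rfl
    · refine ⟨hQzero 0 x _ ?_, hQzero 1 (-y) _ ?_⟩ <;> ext j <;> rw [hBT] <;>
        simp [hB, hl3] <;> ring
    · refine ⟨hQzero 2 z _ ?_, hQzero 3 1 _ ?_⟩ <;> ext j <;> rw [hBT] <;>
        simp [hB, hl3] <;> ring)
  exact ⟨⟨B, _, _, _, _, hdet, hα, hβ, hκ, fun p => by rw [hGform, hout],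
    fun m m' => by rw [hQform, hin]⟩, fun i => (B *ᵥ v i) 2, c0, c1, c2, c3⟩

/-! ### The slope relation and the common point of all diagonals -/

namespace SymmetricFrame

variable {γ Γ : Conic} (F : SymmetricFrame γ Γ)

theorem mulVec_ne_zero {p : Fin 3 → ℂ} (hp : p ≠ 0) : F.B *ᵥ p ≠ 0 :=
  Poncelet.mulVec_ne_zero F.det_ne_zero hp

theorem exists_transpose_mulVec_eq (l : Fin 3 → ℂ) : ∃ m, F.Bᵀ *ᵥ m = l :=
  ⟨(F.Bᵀ)⁻¹ *ᵥ l, by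
    rw [mulVec_mulVec, mul_nonsing_inv _ (isUnit_iff_ne_zero.mpr (by
      rw [det_transpose]; exact F.det_ne_zero)), one_mulVec]⟩

theorem dotProduct_transpose_mulVec (p m : Fin 3 → ℂ) :
    p ⬝ᵥ F.Bᵀ *ᵥ m = (F.B *ᵥ p) ⬝ᵥ m := by
  rw [mulVec_transpose, dotProduct_comm, ← dotProduct_mulVec, dotProduct_comm]

theorem transpose_mulVec_cross_eq_zero {m m' : Fin 3 → ℂ} (h : m ⨯₃ m' = 0) :
    (F.Bᵀ *ᵥ m) ⨯₃ (F.Bᵀ *ᵥ m') = 0 := by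
  by_cases hm : m = 0
  · simp [hm]
  · obtain ⟨c, rfl⟩ := exists_smul_eq_of_cross_eq_zero hm h
    rw [mulVec_smul, map_smul, cross_self, smul_zero]

/-- Two tangents of the inner conic meeting on the outer conic. -/
theorem slope_relation {m m' p : Fin 3 → ℂ} (hp : p ≠ 0)
    (hpm : p ⬝ᵥ F.Bᵀ *ᵥ m = 0) (hpm' : p ⬝ᵥ F.Bᵀ *ᵥ m' = 0)
    (hne : (F.Bᵀ *ᵥ m) ⨯₃ (F.Bᵀ *ᵥ m') ≠ 0)
    (hm : (F.Bᵀ *ᵥ m) ⬝ᵥ γ.dual.mat *ᵥ (F.Bᵀ *ᵥ m) = 0)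
    (hm' : (F.Bᵀ *ᵥ m') ⬝ᵥ γ.dual.mat *ᵥ (F.Bᵀ *ᵥ m') = 0)
    (hΓ : p ⬝ᵥ Γ.mat *ᵥ p = 0) :
    F.β * m 0 * m' 0 + F.α * m 1 * m' 1 = 0 ∧ ∃ c : ℂ, F.B *ᵥ p = c • (m ⨯₃ m') := by
  rw [F.dotProduct_transpose_mulVec] at hpm hpm'
  have hcross : m ⨯₃ m' ≠ 0 := fun h => hne (F.transpose_mulVec_cross_eq_zero h)
  obtain ⟨c, hc⟩ := exists_smul_cross_eq hcross hpm hpm'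
  refine ⟨?_, c, hc⟩
  have hc0 : c ≠ 0 := by
    rintro rfl
    exact F.mulVec_ne_zero hp (by simpa using hc)
  have hq : (F.Bᵀ *ᵥ m) ⬝ᵥ γ.dual.mat *ᵥ (F.Bᵀ *ᵥ m') ≠ 0 := fun h =>
    hne (cross_eq_zero_of_isotropic γ.dual.isSymm γ.dual.det_ne_zero hm hm' h)
  rw [F.inner] at hm hm' hq
  rw [F.outer, hc] at hΓ
  simp only [cross_apply, Pi.smul_apply, smul_eq_mul, cons_val_zero, cons_val_one,
    cons_val] at hΓ
  -- Modulo the tangency equations of `m` and `m'`, the equation of Γ at `m ⨯₃ m'` factors into the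
  -- dual form paired on `m`, `m'` and the slope relation. The first factor is nonzero for distinct
  -- tangents.
  have : c ^ 2 * 2 * ((F.κ * (m 0 * m' 0 + m 1 * m' 1 - m 2 * m' 2) +
      F.k * (m 0 * m' 1 + m 1 * m' 0)) * (F.β * m 0 * m' 0 + F.α * m 1 * m' 1)) = 0 := by
    linear_combination F.κ * hΓ + c ^ 2 * (F.α * m' 1 ^ 2 + F.β * m' 0 ^ 2) * hm +
      c ^ 2 * (F.α * m 1 ^ 2 + F.β * m 0 ^ 2) * hm'
  simpa [hc0, hq] using this

/-- Tangents of the inner conic with proportional `(u, v)`-coordinates are equal or symmetric. -/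
theorem eq_smul_reflection {m m' m₁ : Fin 3 → ℂ}
    (hne : (F.Bᵀ *ᵥ m) ⨯₃ (F.Bᵀ *ᵥ m') ≠ 0) (hm₁0 : F.Bᵀ *ᵥ m₁ ≠ 0)
    (hm : (F.Bᵀ *ᵥ m) ⬝ᵥ γ.dual.mat *ᵥ (F.Bᵀ *ᵥ m) = 0)
    (hm' : (F.Bᵀ *ᵥ m') ⬝ᵥ γ.dual.mat *ᵥ (F.Bᵀ *ᵥ m') = 0)
    (hm₁ : (F.Bᵀ *ᵥ m₁) ⬝ᵥ γ.dual.mat *ᵥ (F.Bᵀ *ᵥ m₁) = 0)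
    (h : F.β * m 0 * m₁ 0 + F.α * m 1 * m₁ 1 = 0)
    (h' : F.β * m₁ 0 * m' 0 + F.α * m₁ 1 * m' 1 = 0) :
    ∃ c : ℂ, m' = c • ![m 0, m 1, -m 2] := by
  have key : ∀ x : Fin 3 → ℂ, F.Bᵀ *ᵥ x ≠ 0 →
      (F.Bᵀ *ᵥ x) ⬝ᵥ γ.dual.mat *ᵥ (F.Bᵀ *ᵥ x) = 0 → x 0 ≠ 0 ∨ x 1 ≠ 0 := by
    intro x hx0 hx
    by_contra! h01
    rw [F.inner, h01.1, h01.2] at hx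
    have h2 : x 2 = 0 := by simpa [F.κ_ne_zero] using hx
    apply hx0
    rw [show x = 0 by ext i; fin_cases i <;> simp [h01, h2], mulVec_zero]
  have hm0 : F.Bᵀ *ᵥ m ≠ 0 := fun h0 => hne (by rw [h0]; simp)
  have hprop : m 0 * m' 1 - m 1 * m' 0 = 0 := by
    rcases key m₁ hm₁0 hm₁ with h0 | h1
    · have : F.β * m₁ 0 * (m 0 * m' 1 - m 1 * m' 0) = 0 := by
        linear_combination m' 1 * h - m 1 * h'
      simpa [F.β_ne_zero, h0] using this
    · have : F.α * m₁ 1 * (m 0 * m' 1 - m 1 * m' 0) = 0 := by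
        linear_combination m 0 * h' - m' 0 * h
      simpa [F.α_ne_zero, h1] using this
  obtain ⟨c, h0, h1⟩ : ∃ c, m' 0 = c * m 0 ∧ m' 1 = c * m 1 := by
    rcases key m hm0 hm with h0 | h1
    · exact ⟨m' 0 / m 0, by field_simp, by field_simp; linear_combination hprop⟩
    · exact ⟨m' 1 / m 1, by field_simp; linear_combination -hprop, by field_simp⟩
  rw [F.inner] at hm hm'
  -- Once the first two coordinates match, the dual conic determines the third up to sign; equal
  -- signs would make the two tangents coincide.
  have hsq : F.κ * ((m' 2 - c * m 2) * (m' 2 + c * m 2)) = 0 := by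
    rw [h0, h1] at hm'
    linear_combination c ^ 2 * hm - hm'
  refine ⟨c, ?_⟩
  rcases mul_eq_zero.mp ((mul_eq_zero.mp hsq).resolve_left F.κ_ne_zero) with h2 | h2
  · refine absurd (F.transpose_mulVec_cross_eq_zero ?_) hne
    have : m' = c • m := by
      ext i
      fin_cases i
      · exact h0
      · exact h1
      · exact sub_eq_zero.mp h2
    rw [this, map_smul, cross_self, smul_zero]
  · ext i
    fin_cases i
    · exact h0
    · exact h1
    · simpa using eq_neg_of_add_eq_zero_left h2

/-- The diagonals of a nondegenerate Poncelet quadrilateral pass through the center of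
symmetry. -/
theorem diagonal (P : PonceletPolygon γ Γ 4) (hP : ¬ P.IsDegenerate) (i : Fin 4) :
    (F.B *ᵥ (P.vertex i).rep) 0 * (F.B *ᵥ (P.vertex (i + 1 + 1)).rep) 1 =
      (F.B *ᵥ (P.vertex i).rep) 1 * (F.B *ᵥ (P.vertex (i + 1 + 1)).rep) 0 := by
  choose m hm using fun j => F.exists_transpose_mulVec_eq (P.side j).rep
  have hq : ∀ j, (F.Bᵀ *ᵥ m j) ⬝ᵥ γ.dual.mat *ᵥ (F.Bᵀ *ᵥ m j) = 0 := fun j => by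
    rw [hm]
    exact γ.dual.mem_points_iff_rep.mp (γ.mem_dual_points (P.side_mem j))
  have h0 : ∀ j, F.Bᵀ *ᵥ m j ≠ 0 := fun j => by
    rw [hm]
    exact (P.side j).rep_nonzero
  have hs : ∀ j, F.β * m j 0 * m (j + 1) 0 + F.α * m j 1 * m (j + 1) 1 = 0 ∧
      ∃ c : ℂ, F.B *ᵥ (P.vertex (j + 1)).rep = c • (m j ⨯₃ m (j + 1)) := by
    intro j
    refine F.slope_relation (P.vertex (j + 1)).rep_nonzero ?_ ?_ ?_ (hq j) (hq _)
      (Γ.mem_points_iff_rep.mp (P.vertex_mem _))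
    · rw [hm]; exact onLine_iff_rep.mp (P.next_onLine j)
    · rw [hm]; exact onLine_iff_rep.mp (P.vertex_onLine (j + 1))
    · rw [hm, hm]; exact cross_rep_eq_zero_iff.not.mpr (P.side_ne_next hP j)
  have hr : ∀ j, ∃ c : ℂ, m (j + 1 + 1) = c • ![m j 0, m j 1, -m j 2] := by
    intro j
    refine F.eq_smul_reflection ?_ (h0 (j + 1)) (hq j) (hq _) (hq _) (hs j).1 (hs (j + 1)).1
    rw [hm, hm]
    exact cross_rep_eq_zero_iff.not.mpr (P.side_ne_next_next hP j)
  obtain ⟨j, rfl⟩ : ∃ j, i = j + 1 := ⟨i - 1, (sub_add_cancel i 1).symm⟩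
  obtain ⟨c, hc⟩ := (hs j).2
  obtain ⟨d, hd⟩ := (hs (j + 1 + 1)).2
  obtain ⟨a, ha⟩ := hr j
  obtain ⟨b, hb⟩ := hr (j + 1)
  -- Reflecting both sides through a vertex negates the first two coordinates of their cross
  -- product, up to scale.
  rw [hc, hd, ha, hb]
  simp [cross_apply]
  ring

end SymmetricFrame

/-! ### Affine vertices and the direction of the diagonals -/

/-- The standard homogeneous coordinates of a finite point. -/
def homog (w : ℂ × ℂ) : Fin 3 → ℂ := ![w.1, w.2, 1]

theorem homog_ne_zero (w : ℂ × ℂ) : homog w ≠ 0 := fun h => one_ne_zero (congrFun h 2)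

theorem homog_mem_points {C : Conic} {w : ℂ × ℂ} (h : finitePoint w ∈ C.points) :
    homog w ⬝ᵥ C.mat *ᵥ homog w = 0 :=
  h

namespace PonceletPolygon

variable {γ Γ : Conic}

theorem HasVertices.exists_rep_eq {n : ℕ} [NeZero n] {P : PonceletPolygon γ Γ n}
    {W : Fin n → ℂ × ℂ} (hW : P.HasVertices W) (i : Fin n) :
    ∃ c : ℂ, c ≠ 0 ∧ (P.vertex i).rep = c • homog (W i) := by
  obtain ⟨c, hc⟩ := Projectivization.exists_smul_eq_mk_rep ℂ (homog (W i)) (homog_ne_zero _)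
  refine ⟨c, c.ne_zero, ?_⟩
  rw [hW i]
  exact hc.symm

/-- The vertices of a nondegenerate Poncelet polygon are in general position. -/
theorem HasVertices.not_collinear {n : ℕ} [NeZero n] {P : PonceletPolygon γ Γ n}
    {W : Fin n → ℂ × ℂ} (hW : P.HasVertices W) (hP : ¬ P.IsDegenerate) (i : Fin n) {a b s : ℂ}
    (hab : a ≠ 0 ∨ b ≠ 0) (h0 : (W (i + 1 + 1)).1 = (W i).1 + s * a)
    (h1 : (W (i + 1 + 1)).2 = (W i).2 + s * b) :
    ((W (i + 1)).1 - (W i).1) * b - ((W (i + 1)).2 - (W i).2) * a ≠ 0 := by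
  intro h
  -- The line through `W i` in direction `(a, b)`.
  set L : Fin 3 → ℂ := ![b, -a, (W i).2 * a - (W i).1 * b]
  have hL : L ≠ 0 := fun e => hab.elim (fun ha => ha (neg_eq_zero.mp (congrFun e 1)))
    (fun hb => hb (congrFun e 0))
  have hon : ∀ j, homog (W j) ⬝ᵥ L = 0 → OnLine (P.vertex j) (Projectivization.mk ℂ L hL) := by
    intro j hj
    rw [hW j]
    exact (onLine_mk (homog_ne_zero _) hL).mpr hj
  have o0 := hon i (by simp [homog, L]; ring)
  have o1 := hon (i + 1) (by simp [homog, L]; linear_combination h)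
  have o2 := hon (i + 1 + 1) (by simp [homog, L, h0, h1]; ring)
  rcases Γ.eq_or_eq_of_onLine (P.vertex_mem i) (P.vertex_mem (i + 1)) (P.vertex_mem (i + 1 + 1))
    o0 o1 o2 (P.vertex_ne_next hP i) with e | e
  · exact P.vertex_ne_next_next hP i e.symm
  · exact P.vertex_ne_next hP (i + 1) e.symm

end PonceletPolygon

theorem exists_mul_of_cross {a b x y : ℂ} (hab : a ≠ 0 ∨ b ≠ 0) (h : x * b = y * a) :
    ∃ s, x = s * a ∧ y = s * b := by
  rcases hab with ha | hb
  · exact ⟨x / a, by field_simp, by field_simp; linear_combination -h⟩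
  · exact ⟨y / b, by field_simp; linear_combination h, by field_simp⟩

/-- If the diagonals of one nondegenerate quadrilateral are parallel, the center of symmetry is at
infinity in their direction. -/
theorem exists_frame_center_at_infinity {γ Γ : Conic} {P : PonceletPolygon γ Γ 4}
    {W : Fin 4 → ℂ × ℂ} (hW : P.HasVertices W) (hP : ¬ P.IsDegenerate) (hA : area W = 0) :
    ∃ (F : SymmetricFrame γ Γ) (a b : ℂ), (a ≠ 0 ∨ b ≠ 0) ∧
      (F.B *ᵥ ![a, b, 0]) 0 = 0 ∧ (F.B *ᵥ ![a, b, 0]) 1 = 0 := by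
  obtain ⟨F, z, h0, h1, h2, h3⟩ := P.exists_symmetricFrame hP
  have hne : ∀ i, (W (i + 1 + 1)).1 - (W i).1 ≠ 0 ∨ (W (i + 1 + 1)).2 - (W i).2 ≠ 0 := by
    intro i
    by_contra! h
    refine P.vertex_ne_next_next hP i ?_
    rw [hW, hW, Prod.ext (sub_eq_zero.mp h.1) (sub_eq_zero.mp h.2)]
  have hd : ((W 3).1 - (W 1).1) * ((W 2).2 - (W 0).2) =
      ((W 3).2 - (W 1).2) * ((W 2).1 - (W 0).1) := by
    have f1 : (1 : Fin 4) + 1 = 2 := rfl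
    have f2 : (2 : Fin 4) + 1 = 3 := rfl
    have f3 : (3 : Fin 4) + 1 = 0 := rfl
    simp only [area, Fin.sum_univ_four, zero_add, f1, f2, f3] at hA
    linear_combination -2 * hA
  obtain ⟨r, hr0, hr1⟩ := exists_mul_of_cross (hne 0) hd
  have hr : r ≠ 0 := by
    rintro rfl
    exact (hne 1).elim (fun h => h (hr0.trans (zero_mul _))) (fun h => h (hr1.trans (zero_mul _)))
  refine ⟨F, _, _, hne 0, ?_⟩
  change (F.B *ᵥ ![(W 2).1 - (W 0).1, (W 2).2 - (W 0).2, 0]) 0 = 0 ∧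
    (F.B *ᵥ ![(W 2).1 - (W 0).1, (W 2).2 - (W 0).2, 0]) 1 = 0
  set D : Fin 3 → ℂ := ![(W 2).1 - (W 0).1, (W 2).2 - (W 0).2, 0] with hD
  have hD1 : D = homog (W 2) - homog (W 0) := by
    ext i
    fin_cases i <;> simp [hD, homog]
  have hD2 : r • D = homog (W 3) - homog (W 1) := by
    ext i
    fin_cases i <;> simp [hD, homog, hr0, hr1]
  have hmul : ∀ i w, F.B *ᵥ (P.vertex i).rep = z i • w →
      ∃ t : ℂ, F.B *ᵥ homog (W i) = t • w := by
    intro i w hw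
    obtain ⟨c, hc, hrep⟩ := hW.exists_rep_eq i
    refine ⟨c⁻¹ * z i, ?_⟩
    rw [mul_smul, ← hw, hrep, mulVec_smul, smul_smul, inv_mul_cancel₀ hc, one_smul]
  obtain ⟨t0, ht0⟩ := hmul 0 _ h0
  obtain ⟨t1, ht1⟩ := hmul 1 _ h1
  obtain ⟨t2, ht2⟩ := hmul 2 _ h2
  obtain ⟨t3, ht3⟩ := hmul 3 _ h3
  have e1 : F.B *ᵥ D = t2 • ![1, -1, 1] - t0 • ![-1, 1, 1] := by
    rw [hD1, mulVec_sub, ht2, ht0]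
  have e2 : r • (F.B *ᵥ D) = t3 • ![1, 1, 1] - t1 • ![-1, -1, 1] := by
    rw [← mulVec_smul, hD2, mulVec_sub, ht3, ht1]
  have a0 := congrFun e1 0
  have a1 := congrFun e1 1
  have b0 := congrFun e2 0
  have b1 := congrFun e2 1
  simp at a0 a1 b0 b1
  -- In the frame one diagonal of the square lies on X + Y = 0 and the other on X = Y; the common
  -- direction `D` lies on both.
  have hsum : r * ((F.B *ᵥ D) 0 - (F.B *ᵥ D) 1) = 0 := by linear_combination b0 - b1
  have hdiff := (mul_eq_zero.mp hsum).resolve_left hr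
  constructor
  · linear_combination (a0 + a1 + hdiff) / 2
  · linear_combination (a0 + a1 - hdiff) / 2

theorem SymmetricFrame.diagonal_direction {γ Γ : Conic} (F : SymmetricFrame γ Γ) {a b : ℂ}
    (hab : a ≠ 0 ∨ b ≠ 0) (h0 : (F.B *ᵥ ![a, b, 0]) 0 = 0) (h1 : (F.B *ᵥ ![a, b, 0]) 1 = 0)
    {P : PonceletPolygon γ Γ 4} {W : Fin 4 → ℂ × ℂ} (hW : P.HasVertices W)
    (hP : ¬ P.IsDegenerate) (i : Fin 4) :
    ∃ s, s ≠ 0 ∧ (W (i + 1 + 1)).1 = (W i).1 + s * a ∧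
      (W (i + 1 + 1)).2 = (W i).2 + s * b := by
  obtain ⟨c, hc, hrep⟩ := hW.exists_rep_eq i
  obtain ⟨c', hc', hrep'⟩ := hW.exists_rep_eq (i + 1 + 1)
  have hdiag := F.diagonal P hP i
  rw [hrep, hrep', mulVec_smul, mulVec_smul] at hdiag
  simp only [Pi.smul_apply, smul_eq_mul] at hdiag
  have hx : (F.B *ᵥ homog (W i)) 0 * (F.B *ᵥ homog (W (i + 1 + 1))) 1 -
      (F.B *ᵥ homog (W i)) 1 * (F.B *ᵥ homog (W (i + 1 + 1))) 0 = 0 := by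
    have : c * c' * ((F.B *ᵥ homog (W i)) 0 * (F.B *ᵥ homog (W (i + 1 + 1))) 1 -
      (F.B *ᵥ homog (W i)) 1 * (F.B *ᵥ homog (W (i + 1 + 1))) 0) = 0 := by
      linear_combination hdiag
    simpa [hc, hc'] using this
  -- Collinearity of the opposite vertices with `[a : b : 0]`, checked in the frame, where this
  -- point has only a third coordinate.
  have hdet : (Matrix.of ![homog (W i), homog (W (i + 1 + 1)), ![a, b, 0]]).det * F.B.det = 0 := by
    have : Matrix.of ![homog (W i), homog (W (i + 1 + 1)), ![a, b, 0]] * F.Bᵀ =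
        Matrix.of ![F.B *ᵥ homog (W i), F.B *ᵥ homog (W (i + 1 + 1)), F.B *ᵥ ![a, b, 0]] := by
      ext j k
      fin_cases j <;> simp [mul_apply, mulVec, dotProduct, mul_comm]
    rw [← det_transpose F.B, ← det_mul, this, det_fin_three]
    simp only [of_apply, cons_val_zero, cons_val_one, cons_val, h0, h1]
    linear_combination (F.B *ᵥ ![a, b, 0]) 2 * hx
  have hzero := (mul_eq_zero.mp hdet).resolve_right F.det_ne_zero
  obtain ⟨s, hs0, hs1⟩ := exists_mul_of_cross (x := (W (i + 1 + 1)).1 - (W i).1)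
    (y := (W (i + 1 + 1)).2 - (W i).2) hab (by
      simp [det_fin_three, homog] at hzero
      linear_combination hzero)
  refine ⟨s, ?_, by linear_combination hs0, by linear_combination hs1⟩
  rintro rfl
  refine P.vertex_ne_next_next hP i ?_
  rw [hW, hW, Prod.ext (sub_eq_zero.mp (hs0.trans (zero_mul a)))
    (sub_eq_zero.mp (hs1.trans (zero_mul b)))]

/-! ### The two centers when the diagonals are parallel -/

/-- The `CM2` factor measures the offset between the two parallel diagonals. The `CCM` factor
contains twice the difference of their midpoints, paired with the direction `(a, b)`. -/
theorem coord_of_parallel_diagonals {W : Fin 4 → ℂ × ℂ} {a b s t : ℂ}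
    (h20 : (W 2).1 = (W 0).1 + s * a) (h21 : (W 2).2 = (W 0).2 + s * b)
    (h30 : (W 3).1 = (W 1).1 + t * a) (h31 : (W 3).2 = (W 1).2 + t * b) :
    area W = 0 ∧
    cm2Coord W = (-s * t * (((W 1).1 - (W 0).1) * b - ((W 1).2 - (W 0).2) * a)) • ![a, b, 0] ∧
    ccmCoord W = (-s * t * ((2 * (W 0).1 + s * a - (2 * (W 1).1 + t * a)) * a +
      (2 * (W 0).2 + s * b - (2 * (W 1).2 + t * b)) * b)) • ![-b, a, 0] := by
  have e0 : (0 : Fin 4) - 1 = 3 := rfl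
  have e2 : (2 : Fin 4) - 1 = 1 := rfl
  have e3 : (3 : Fin 4) - 1 = 2 := rfl
  have f1 : (1 : Fin 4) + 1 = 2 := rfl
  have f2 : (2 : Fin 4) + 1 = 3 := rfl
  have f3 : (3 : Fin 4) + 1 = 0 := rfl
  have hA : area W = 0 := by
    simp only [area, Fin.sum_univ_four, zero_add, f1, f2, f3, h20, h21, h30, h31]
    ring
  refine ⟨hA, ?_, ?_⟩ <;> ext i <;> fin_cases i <;>
    simp [cm2Coord, ccmCoord, hA, Fin.sum_univ_four, e0, e2, e3, f1, f2, f3, h20, h21, h30,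
      h31] <;> ring

theorem toPoint_smul {c : ℂ} (hc : c ≠ 0) {v : Fin 3 → ℂ} (hv : v ≠ 0) :
    toPoint (c • v) = some (Projectivization.mk ℂ v hv) := by
  rw [toPoint, dif_pos (smul_ne_zero hc hv)]
  congr 1
  exact (Projectivization.mk_eq_mk_iff' ..).mpr ⟨c, rfl⟩

/-- The direction `(a, b)` is conjugate to the normal direction exactly if the line joining the
midpoints of two parallel chords is perpendicular to them. -/
theorem conjugate_iff_of_parallel_chords {C : Conic} {p q : ℂ × ℂ} {a b s t : ℂ} (hs : s ≠ 0)
    (ht : t ≠ 0) (h : a ≠ 0 ∨ b ≠ 0) (h' : -b ≠ 0 ∨ a ≠ 0) (hp : finitePoint p ∈ C.points)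
    (hp' : finitePoint (p.1 + s * a, p.2 + s * b) ∈ C.points) (hq : finitePoint q ∈ C.points)
    (hq' : finitePoint (q.1 + t * a, q.2 + t * b) ∈ C.points)
    (hpq : (q.1 - p.1) * b - (q.2 - p.2) * a ≠ 0) :
    C.Conjugate (infinitePoint a b h) (infinitePoint (-b) a h') ↔
      (2 * p.1 + s * a - (2 * q.1 + t * a)) * a +
        (2 * p.2 + s * b - (2 * q.2 + t * b)) * b = 0 := by
  set D : Fin 3 → ℂ := ![a, b, 0] with hD
  -- The midpoint of a chord in direction `D` is conjugate to `D`.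
  have hchord : ∀ (w : ℂ × ℂ) (r : ℂ), r ≠ 0 → finitePoint w ∈ C.points →
      finitePoint (w.1 + r * a, w.2 + r * b) ∈ C.points →
      2 * (D ⬝ᵥ C.mat *ᵥ homog w) + r * (D ⬝ᵥ C.mat *ᵥ D) = 0 := by
    intro w r hr hw hw'
    replace hw := homog_mem_points hw
    replace hw' := homog_mem_points hw'
    have hsum : homog (w.1 + r * a, w.2 + r * b) = homog w + r • D := by
      ext i
      fin_cases i <;> simp [homog, hD]
    have hsymm := dotProduct_mulVec_comm C.isSymm D (homog w)
    rw [hsum] at hw'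
    simp only [mulVec_add, mulVec_smul, add_dotProduct, dotProduct_add, smul_dotProduct,
      dotProduct_smul, hw, ← hsymm, smul_eq_mul] at hw'
    have : r * (2 * (D ⬝ᵥ C.mat *ᵥ homog w) + r * (D ⬝ᵥ C.mat *ᵥ D)) = 0 := by
      linear_combination hw'
    exact (mul_eq_zero.mp this).resolve_left hr
  have h1 := hchord p s hs hp hp'
  have h2 := hchord q t ht hq hq'
  set R : Fin 3 → ℂ := D ᵥ* C.mat with hR
  have hRv : ∀ v, D ⬝ᵥ C.mat *ᵥ v = R 0 * v 0 + R 1 * v 1 + R 2 * v 2 := fun v => by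
    rw [dotProduct_mulVec, dotProduct, Fin.sum_univ_three]
  have hDD : D ⬝ᵥ C.mat *ᵥ D = R 0 * a + R 1 * b := by
    rw [hRv]
    simp [hD]
  -- `R` is the polar of `[a : b : 0]`. Were it the line at infinity, `D` would be on the conic and
  -- conjugate to the finite point `p` of the conic, hence equal to it.
  have hDD0 : ¬ (R 0 = 0 ∧ R 1 = 0) := by
    rintro ⟨r0, r1⟩
    have hDD' : D ⬝ᵥ C.mat *ᵥ D = 0 := by rw [hDD, r0, r1]; ring
    have hDp : D ⬝ᵥ C.mat *ᵥ homog p = 0 := by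
      linear_combination (h1 - s * hDD') / 2
    have hc := cross_eq_zero_of_isotropic C.isSymm C.det_ne_zero hDD' (homog_mem_points hp) hDp
    have c0 := congrFun hc 0
    have c1 := congrFun hc 1
    simp [cross_apply, hD, homog] at c0 c1
    exact h.elim (fun ha => ha c1) (fun hb => hb c0)
  have hconj : C.Conjugate (infinitePoint a b h) (infinitePoint (-b) a h') ↔
      R 1 * a - R 0 * b = 0 := by
    change D ⬝ᵥ C.mat *ᵥ ![-b, a, 0] = 0 ↔ _
    rw [hRv]
    simp only [cons_val_zero, cons_val_one, cons_val]
    rw [show R 0 * -b + R 1 * a + R 2 * 0 = R 1 * a - R 0 * b by ring]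
  rw [hconj]
  set n0 := 2 * p.1 + s * a - (2 * q.1 + t * a) with hn0
  set n1 := 2 * p.2 + s * b - (2 * q.2 + t * b) with hn1
  -- Both midpoints lie on the polar `R`, so their difference is along it. Since `(R 0, R 1)` and
  -- `(n0, n1)` are nonzero, `(n0, n1)` is perpendicular to `(a, b)` exactly when `(R 0, R 1)` is
  -- parallel to it.
  have hn : R 0 * n0 + R 1 * n1 = 0 := by
    rw [hDD, hRv] at h1 h2
    simp only [homog, cons_val_zero, cons_val_one, cons_val] at h1 h2
    rw [hn0, hn1]
    linear_combination h1 - h2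
  constructor
  · intro hc
    by_contra hne
    refine hDD0 ⟨?_, ?_⟩
    · refine (mul_eq_zero.mp ?_).resolve_right hne
      linear_combination a * hn - n1 * hc
    · refine (mul_eq_zero.mp ?_).resolve_right hne
      linear_combination b * hn + n0 * hc
  · intro hc
    have m0 : n0 * (R 1 * a - R 0 * b) = 0 := by linear_combination R 1 * hc - b * hn
    have m1 : n1 * (R 1 * a - R 0 * b) = 0 := by linear_combination a * hn - R 0 * hc
    by_contra hne
    have z0 := (mul_eq_zero.mp m0).resolve_right hne
    have z1 := (mul_eq_zero.mp m1).resolve_right hne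
    apply hpq
    rw [hn0] at z0
    rw [hn1] at z1
    linear_combination (a * z1 - b * z0) / 2

end Poncelet

theorem mainTheorem6 (γ Γ : Poncelet.Conic) (hfam : Poncelet.AdmitsFamily γ Γ 4)
    (P₀ : Poncelet.PonceletPolygon γ Γ 4) (W₀ : Fin 4 → ℂ × ℂ) (hW₀ : P₀.HasVertices W₀)
    (hP₀ : ¬ P₀.IsDegenerate) (hA₀ : Poncelet.area W₀ = 0) :
    (∀ (P : Poncelet.PonceletPolygon γ Γ 4) (W : Fin 4 → ℂ × ℂ), P.HasVertices W →
      Poncelet.area W = 0) ∧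
    ∃ (a b : ℂ) (h : a ≠ 0 ∨ b ≠ 0) (h' : -b ≠ 0 ∨ a ≠ 0),
      (∀ (P : Poncelet.PonceletPolygon γ Γ 4) (W : Fin 4 → ℂ × ℂ), P.HasVertices W →
        (P.IsDegenerate → Poncelet.CM2 W = none ∧ Poncelet.CCM W = none) ∧
        (¬ P.IsDegenerate →
          Poncelet.CM2 W = some (Poncelet.infinitePoint a b h) ∧
          (¬ Γ.Conjugate (Poncelet.infinitePoint a b h) (Poncelet.infinitePoint (-b) a h') →
            Poncelet.CCM W = some (Poncelet.infinitePoint (-b) a h')) ∧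
          (Γ.Conjugate (Poncelet.infinitePoint a b h) (Poncelet.infinitePoint (-b) a h') →
            Poncelet.CCM W = none))) := by
  obtain ⟨F, a, b, hab, hc0, hc1⟩ := Poncelet.exists_frame_center_at_infinity hW₀ hP₀ hA₀
  have hdir : ∀ (P : Poncelet.PonceletPolygon γ Γ 4) (W : Fin 4 → ℂ × ℂ), P.HasVertices W →
      ¬ P.IsDegenerate → ∃ s t : ℂ, s ≠ 0 ∧ t ≠ 0 ∧
        ((W 2).1 = (W 0).1 + s * a ∧ (W 2).2 = (W 0).2 + s * b) ∧
        ((W 3).1 = (W 1).1 + t * a ∧ (W 3).2 = (W 1).2 + t * b) := by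
    intro P W hW hP
    obtain ⟨s, hs, hs'⟩ := F.diagonal_direction hab hc0 hc1 hW hP 0
    obtain ⟨t, ht, ht'⟩ := F.diagonal_direction hab hc0 hc1 hW hP 1
    exact ⟨s, t, hs, ht, hs', ht'⟩
  have hab' : -b ≠ 0 ∨ a ≠ 0 := hab.symm.imp_left neg_ne_zero.mpr
  refine ⟨fun P W hW => ?_, a, b, hab, hab', fun P W hW => ⟨fun hP => ?_, fun hP => ?_⟩⟩
  · by_cases hP : P.IsDegenerate
    · exact (hP.coord_eq_zero hW).1
    · obtain ⟨s, t, -, -, ⟨h20, h21⟩, h30, h31⟩ := hdir P W hW hP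
      exact (Poncelet.coord_of_parallel_diagonals h20 h21 h30 h31).1
  · obtain ⟨-, h, h'⟩ := hP.coord_eq_zero hW
    simp [Poncelet.CM2, Poncelet.CCM, Poncelet.toPoint, h, h']
  · obtain ⟨s, t, hs, ht, ⟨h20, h21⟩, h30, h31⟩ := hdir P W hW hP
    obtain ⟨-, hcm, hccm⟩ := Poncelet.coord_of_parallel_diagonals h20 h21 h30 h31
    have hδ := hW.not_collinear hP 0 hab h20 h21
    simp only [zero_add] at hδ
    have hmem : ∀ i, Poncelet.finitePoint (W i) ∈ Γ.points := fun i => hW i ▸ P.vertex_mem i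
    have hconj := Poncelet.conjugate_iff_of_parallel_chords hs ht hab hab' (hmem 0)
      (by rw [← h20, ← h21]; exact hmem 2) (hmem 1) (by rw [← h30, ← h31]; exact hmem 3) hδ
    have hst : -s * t ≠ 0 := mul_ne_zero (neg_ne_zero.mpr hs) ht
    refine ⟨?_, fun hn => ?_, fun hn => ?_⟩
    · rw [Poncelet.CM2, hcm]
      exact Poncelet.toPoint_smul (mul_ne_zero hst hδ) _
    · rw [Poncelet.CCM, hccm]
      exact Poncelet.toPoint_smul (mul_ne_zero hst (hconj.not.mp hn)) _
    · rw [Poncelet.CCM, hccm, hconj.mp hn]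
      simp [Poncelet.toPoint]
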